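/- Let $N\ge 2$ and $d\ge 0$ be integers, and consider sequences $[x_k]=(x_0,\dots,x_N)$ of random vectors in $\mathbb R^d$. A zero-mean nonsingular Gaussian (ZMNG) sequence is one whose stacked vector $(x_0',\dots,x_N')'$ is Gaussian with zero mean and nonsingular covariance matrix. A sequence is Markov if, for every $k$, $(x_i)_{i<k}$ and $(x_i)_{i>k}$ are conditionally independent given $x_k$; it is reciprocal if, for all $j<l$, $(x_i)_{j<i<l}$ and $(x_i)_{i\notin[j,l]}$ are conditionally independent given $(x_j,x_l)$. A reciprocal $CM_L$ model consists of real $d\times d$ matrices $G_{k,k-1}$, $G_{k,N}$, $G_k$, $k\in[1,N-1]$, with every $G_k$ (symmetric) positive definite and $$G_k^{-1}G_{k,N}=G_{k+1,k}'\,G_{k+1}^{-1}G_{k+1,N},\qquad k\in[1,N-2].$$ A boundary condition consists of real $d\times d$ matrices $G_{0,N}$, $G_0$, $G_N$ with $G_0,G_N$ positive definite. A sequence $[x_k]$ is modeled by the $CM_L$ model with this boundary condition if, almost surely, $$x_k=G_{k,k-1}x_{k-1}+G_{k,N}x_N+e_k\quad(k\in[1,N-1]),\qquad x_N=e_N,\qquad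 x_0=G_{0,N}x_N+e_0,$$ for some white (i.e. $\mathrm{Cov}(e_k,e_l)=0$ for $k\ne l$) ZMNG sequence $[e_k]$ with $\mathrm{Cov}(e_k)=G_k$ for $k\in[0,N]$. Fix any reciprocal $CM_L$ model. Then: (i) for every boundary condition there is a sequence modeled by the model with this boundary condition, and every such sequence is ZMNG and reciprocal; (ii) the set of reciprocal sequences modeled by the model (with arbitrary boundary conditions) includes Markov sequences; (iii) more precisely, for all positive definite $G_0$ and $G_N$, every sequence modeled by the model with the boundary condition given by $G_0$, $G_N$ and $$G_{0,N}=G_0\,G_{1,0}'\,G_1^{-1}\,G_{1,N}$$ is Markov. -/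

import Mathlib

open MeasureTheory ProbabilityTheory

namespace CMSeq

/-! Sequences over `[0, N]` of `d`-dimensional random vectors are written as functions
`x : ℕ → Ω → Fin d → ℝ`; only the values `x k` with `k ≤ N` ever play a role. -/

/-- Conditional independence of the sub-σ-algebras `m₁`, `m₂` given `m`, with respect to `P`:
`P(A ∩ B | m) = P(A | m) P(B | m)` almost surely for all `A ∈ m₁`, `B ∈ m₂`.
(No topological assumption on `Ω` is needed in this form.) -/
def CondIndepGiven {Ω : Type*} (m m₁ m₂ : MeasurableSpace Ω) {_mΩ : MeasurableSpace Ω}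
    (P : Measure Ω) : Prop :=
  ∀ A B : Set Ω, MeasurableSet[m₁] A → MeasurableSet[m₂] B →
    P[(A ∩ B).indicator (fun _ => (1 : ℝ)) | m] =ᵐ[P]
      P[A.indicator (fun _ => (1 : ℝ)) | m] * P[B.indicator (fun _ => (1 : ℝ)) | m]

/-- On a standard Borel space this is Mathlib's conditional independence. -/
theorem condIndepGiven_iff_condIndep {Ω : Type*} (m m₁ m₂ : MeasurableSpace Ω)
    {mΩ : MeasurableSpace Ω} [StandardBorelSpace Ω] (hm : m ≤ mΩ) (hm₁ : m₁ ≤ mΩ) (hm₂ : m₂ ≤ mΩ)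
    (P : Measure Ω) [IsFiniteMeasure P] :
    CondIndepGiven m m₁ m₂ P ↔ CondIndep m m₁ m₂ hm (μ := P) :=
  (condIndep_iff m m₁ m₂ hm hm₁ hm₂ P).symm

/-- The σ-algebra generated by the states `x i`, `i ∈ S`. -/
def sigmaOf {Ω : Type*} {d : ℕ} (x : ℕ → Ω → Fin d → ℝ) (S : Set ℕ) : MeasurableSpace Ω :=
  ⨆ i ∈ S, MeasurableSpace.comap (x i) inferInstance

/-- `[x_k]` is Markov over `[0, N]`: conditioned on the state at any time `k`, the segment
before `k` is independent of the segment after `k`. -/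
def IsMarkov {Ω : Type*} {_mΩ : MeasurableSpace Ω} {d : ℕ} (N : ℕ) (x : ℕ → Ω → Fin d → ℝ)
    (P : Measure Ω) : Prop :=
  ∀ k ≤ N, CondIndepGiven (sigmaOf x {k}) (sigmaOf x {i | i < k})
    (sigmaOf x {i | k < i ∧ i ≤ N}) P

/-- `[x_k]` is reciprocal over `[0, N]`: conditioned on the states at any two times `j < l`, the
segment inside `(j, l)` is independent of the two segments outside `[j, l]`. -/
def IsReciprocal {Ω : Type*} {_mΩ : MeasurableSpace Ω} {d : ℕ} (N : ℕ) (x : ℕ → Ω → Fin d → ℝ)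
    (P : Measure Ω) : Prop :=
  ∀ j l : ℕ, j < l → l ≤ N →
    CondIndepGiven (sigmaOf x {j, l}) (sigmaOf x {i | j < i ∧ i < l})
      (sigmaOf x {i | i < j ∨ (l < i ∧ i ≤ N)}) P

/-- The cross-covariance matrix `C_{k,l}` of `x k` and `x l`. -/
noncomputable def crossCov {Ω : Type*} {_mΩ : MeasurableSpace Ω} {d : ℕ}
    (x : ℕ → Ω → Fin d → ℝ) (P : Measure Ω) (k l : ℕ) : Matrix (Fin d) (Fin d) ℝ :=
  Matrix.of fun i j => covariance (fun ω => x k ω i) (fun ω => x l ω j) P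

/-- The covariance matrix `C` of the stacked vector `[x_0', …, x_N']'`. -/
noncomputable def fullCov {Ω : Type*} {_mΩ : MeasurableSpace Ω} {d : ℕ} (N : ℕ)
    (x : ℕ → Ω → Fin d → ℝ) (P : Measure Ω) :
    Matrix (Fin (N + 1) × Fin d) (Fin (N + 1) × Fin d) ℝ :=
  Matrix.of fun p q => crossCov x P p.1 q.1 p.2 q.2

/-- `[x_k]` is a zero-mean nonsingular Gaussian (ZMNG) sequence over `[0, N]`: the stacked vector
is Gaussian, has zero mean and a nonsingular covariance matrix. -/
structure IsZMNG {Ω : Type*} {_mΩ : MeasurableSpace Ω} {d : ℕ} (N : ℕ)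
    (x : ℕ → Ω → Fin d → ℝ) (P : Measure Ω) : Prop where
  measurable : ∀ k ≤ N, Measurable (x k)
  gaussian : HasGaussianLaw (fun ω (p : Fin (N + 1) × Fin d) => x p.1 ω p.2) P
  zeroMean : ∀ k ≤ N, ∀ i, ∫ ω, x k ω i ∂P = 0
  nonsingular : (fullCov N x P).det ≠ 0

/-- `[e_k]` is a zero-mean white NG sequence over `[0, N]` with `Cov(e_k) = Q k`. -/
structure IsWhiteNG {Ω : Type*} {_mΩ : MeasurableSpace Ω} {d : ℕ} (N : ℕ)
    (e : ℕ → Ω → Fin d → ℝ) (Q : ℕ → Matrix (Fin d) (Fin d) ℝ) (P : Measure Ω) : Prop where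
  zmng : IsZMNG N e P
  cov_self : ∀ k ≤ N, crossCov e P k k = Q k
  cov_ne : ∀ k ≤ N, ∀ l ≤ N, k ≠ l → crossCov e P k l = 0

/-- Parameters of a `CM_L` model over `[0, N]`: `prev k` is `G_{k,k-1}`, `last k` is `G_{k,N}` and
`cov k` is the positive definite `G_k`. Only the values for `k ∈ [1, N-1]` play a role. -/
structure CMLModel (N d : ℕ) where
  prev : ℕ → Matrix (Fin d) (Fin d) ℝ
  last : ℕ → Matrix (Fin d) (Fin d) ℝ
  cov : ℕ → Matrix (Fin d) (Fin d) ℝ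
  cov_posDef : ∀ k, 1 ≤ k → k < N → (cov k).PosDef

/-- A reciprocal `CM_L` model: `G_k⁻¹ G_{k,N} = G_{k+1,k}' G_{k+1}⁻¹ G_{k+1,N}` for
`k ∈ [1, N-2]`. -/
def CMLModel.IsReciprocalModel {N d : ℕ} (G : CMLModel N d) : Prop :=
  ∀ k, 1 ≤ k → k + 2 ≤ N →
    (G.cov k)⁻¹ * G.last k = (G.prev (k + 1)).transpose * (G.cov (k + 1))⁻¹ * G.last (k + 1)

/-- Parameters of the boundary condition `x_N = e_N`, `x_0 = G_{0,N} x_N + e_0`. -/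
structure Boundary (d : ℕ) where
  G0N : Matrix (Fin d) (Fin d) ℝ
  G0 : Matrix (Fin d) (Fin d) ℝ
  GN : Matrix (Fin d) (Fin d) ℝ
  G0_posDef : G0.PosDef
  GN_posDef : GN.PosDef

/-- Noise covariances `G_0, G_1, …, G_N` of a model with a boundary condition. -/
def noiseCov {N d : ℕ} (G : CMLModel N d) (b : Boundary d) (k : ℕ) : Matrix (Fin d) (Fin d) ℝ :=
  if k = 0 then b.G0 else if k = N then b.GN else G.cov k

/-- `[x_k]` obeys the `CM_L` model `G` with the boundary condition `b`, that is, it is driven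
(almost surely) by a zero-mean white NG sequence `[e_k]` with `Cov(e_k) = G_k`, `k ∈ [0, N]`. -/
def Obeys {Ω : Type*} {_mΩ : MeasurableSpace Ω} {N d : ℕ} (G : CMLModel N d) (b : Boundary d)
    (x : ℕ → Ω → Fin d → ℝ) (P : Measure Ω) : Prop :=
  (∀ k ≤ N, Measurable (x k)) ∧
  ∃ e : ℕ → Ω → Fin d → ℝ, IsWhiteNG N e (noiseCov G b) P ∧
    (∀ k, 1 ≤ k → k < N → ∀ᵐ ω ∂P,
      x k ω = (G.prev k).mulVec (x (k - 1) ω) + (G.last k).mulVec (x N ω) + e k ω) ∧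
    (∀ᵐ ω ∂P, x N ω = e N ω) ∧
    (∀ᵐ ω ∂P, x 0 ω = b.G0N.mulVec (x N ω) + e 0 ω)

end CMSeq

namespace CMSeq

/-- If `U` is independent of `W`, the conditional probability of `(U, φ W) ∈ M` given `W` is
obtained by integrating out `U`. -/
theorem condExp_indicator_preimage_of_indepFun {Ω E F H : Type*} {mΩ : MeasurableSpace Ω}
    [MeasurableSpace E] [mF : MeasurableSpace F] [MeasurableSpace H] {P : Measure Ω}
    [IsProbabilityMeasure P] {U : Ω → E} {W : Ω → F} {φ : F → H} (hU : Measurable U)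
    (hW : Measurable W) (hφ : Measurable φ) (hUW : IndepFun U W P) {M : Set (E × H)}
    (hM : MeasurableSet M) :
    (fun ω => ((P.map U) ((fun u => (u, φ (W ω))) ⁻¹' M)).toReal) =ᵐ[P]
      P[((fun ω => (U ω, φ (W ω))) ⁻¹' M).indicator (fun _ => (1 : ℝ)) | mF.comap W] := by
  have hA : MeasurableSet ((fun ω => (U ω, φ (W ω))) ⁻¹' M) := by measurability
  have : IsProbabilityMeasure (P.map U) := Measure.isProbabilityMeasure_map hU.aemeasurable
  have : IsProbabilityMeasure (P.map W) := Measure.isProbabilityMeasure_map hW.aemeasurable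
  have hh : Measurable fun z => (P.map U) ((fun u => (u, z)) ⁻¹' M) :=
    measurable_measure_prodMk_right hM
  have hint : Integrable (fun ω => ((P.map U) ((fun u => (u, φ (W ω))) ⁻¹' M)).toReal) P :=
    Integrable.of_bound (hh.comp (hφ.comp hW)).ennreal_toReal.aestronglyMeasurable 1
      (.of_forall fun ω => by
        rw [Real.norm_of_nonneg ENNReal.toReal_nonneg]
        exact measureReal_le_one)
  refine ae_eq_condExp_of_forall_setIntegral_eq hW.comap_le ?_ ?_ ?_ ?_
  · exact (integrable_const 1).indicator hA
  · exact fun s _ _ => hint.integrableOn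
  · rintro s ⟨D, hD, rfl⟩ -
    have e0 : Measurable fun ω => (P.map U) ((fun u => (u, φ (W ω))) ⁻¹' M) :=
      hh.comp (hφ.comp hW)
    rw [integral_toReal e0.aemeasurable (.of_forall fun ω => measure_lt_top _ _),
      setIntegral_indicator hA]
    simp only [integral_const, smul_eq_mul, mul_one, measureReal_restrict_apply_univ]
    unfold Measure.real
    congr 1
    have hM' : MeasurableSet ({q : E × F | (q.1, φ q.2) ∈ M} ∩ Set.univ ×ˢ D) := by measurability
    have key := Measure.prod_apply_symm (μ := P.map U) (ν := P.map W) hM'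
    rw [← (indepFun_iff_map_prod_eq_prod_map_map hU.aemeasurable hW.aemeasurable).1 hUW,
      Measure.map_apply (by fun_prop) hM'] at key
    have e1 : W ⁻¹' D ∩ (fun ω => (U ω, φ (W ω))) ⁻¹' M =
        (fun ω => (U ω, W ω)) ⁻¹' ({q : E × F | (q.1, φ q.2) ∈ M} ∩ Set.univ ×ˢ D) := by
      ext ω; simp [and_comm]
    have e2 := setLIntegral_map hD (hh.comp hφ) hW (μ := P)
    simp only [Function.comp_apply] at e2
    rw [e1, key, ← e2, ← lintegral_indicator hD]
    refine lintegral_congr fun w => ?_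
    by_cases hw : w ∈ D <;> simp [hw, Set.preimage]
  · refine Measurable.aestronglyMeasurable ?_
    exact (hh.comp hφ).ennreal_toReal.comp (comap_measurable W)

theorem condIndepGiven_of_indepFun {Ω E F H : Type*} {mA mΩ : MeasurableSpace Ω}
    [mE : MeasurableSpace E] [mF : MeasurableSpace F] [mH : MeasurableSpace H] {P : Measure Ω}
    [IsProbabilityMeasure P] {U : Ω → E} {Z : Ω → F} {Y : Ω → H} (hU : Measurable U)
    (hZ : Measurable Z) (hY : Measurable Y) (h : IndepFun U (fun ω => (Z ω, Y ω)) P)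
    (hA : mA ≤ (mE.prod mF).comap fun ω => (U ω, Z ω)) :
    CondIndepGiven (mF.comap Z) mA (mH.comap Y) P := by
  intro A B hAm hB
  obtain ⟨M, hM, rfl⟩ := hA _ hAm
  have hZY : Measurable fun ω => (Z ω, Y ω) := hZ.prodMk hY
  have hUZ : Measurable fun ω => (U ω, Z ω) := hU.prodMk hZ
  have h1 := condExp_indicator_preimage_of_indepFun hU hZY measurable_fst h hM
  have h2 := condExp_indicator_preimage_of_indepFun hU hZ measurable_id
    (h.comp measurable_id measurable_fst) hM
  simp only [id] at h1 h2
  set A := (fun ω => (U ω, Z ω)) ⁻¹' M with hAdef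
  set f : Ω → ℝ := A.indicator fun _ => 1 with hf
  set g : Ω → ℝ := B.indicator fun _ => 1 with hg
  set k := fun ω => ((P.map U) ((fun u => (u, Z ω)) ⁻¹' M)).toReal with hk
  have hfi : Integrable f P := (integrable_const 1).indicator (hUZ hM)
  have hgi : Integrable g P := (integrable_const 1).indicator (hY.comap_le _ hB)
  have hle : mF.comap Z ≤ (mF.prod mH).comap fun ω => (Z ω, Y ω) := by
    rw [← measurable_iff_comap_le]
    exact measurable_fst.comp (comap_measurable _)
  have hleY : mH.comap Y ≤ (mF.prod mH).comap fun ω => (Z ω, Y ω) := by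
    rw [← measurable_iff_comap_le]
    exact measurable_snd.comp (comap_measurable _)
  have hkm : StronglyMeasurable[mF.comap Z] k :=
    ((measurable_measure_prodMk_right hM).ennreal_toReal.comp
      (comap_measurable Z)).stronglyMeasurable
  have hgm : StronglyMeasurable[(mF.prod mH).comap fun ω => (Z ω, Y ω)] g :=
    stronglyMeasurable_const.indicator (hleY _ hB)
  have hprod : (A ∩ B).indicator (fun _ => (1 : ℝ)) = f * g := by
    ext ω
    by_cases h1 : ω ∈ A <;> by_cases h2 : ω ∈ B <;> simp [hf, hg, h1, h2]
  have hfgi : Integrable (f * g) P := by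
    rw [← hprod]
    exact (integrable_const 1).indicator ((hUZ hM).inter (hY.comap_le _ hB))
  have hkgi : Integrable (k * g) P := by
    refine hgi.bdd_mul (c := 1) (hkm.mono hZ.comap_le).aestronglyMeasurable (.of_forall fun ω => ?_)
    have : IsProbabilityMeasure (P.map U) := Measure.isProbabilityMeasure_map hU.aemeasurable
    rw [Real.norm_of_nonneg ENNReal.toReal_nonneg]
    exact measureReal_le_one
  rw [hprod]
  calc P[f * g | mF.comap Z]
      =ᵐ[P] P[P[f * g | (mF.prod mH).comap fun ω => (Z ω, Y ω)] | mF.comap Z] :=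
        (condExp_condExp_of_le hle hZY.comap_le).symm
    _ =ᵐ[P] P[k * g | mF.comap Z] := by
        refine condExp_congr_ae ?_
        refine (condExp_mul_of_stronglyMeasurable_right hgm hfgi hfi).trans ?_
        filter_upwards [h1] with ω hω
        exact congrArg (· * g ω) hω.symm
    _ =ᵐ[P] k * P[g | mF.comap Z] := condExp_mul_of_stronglyMeasurable_left hkm hkgi hgi
    _ =ᵐ[P] P[f | mF.comap Z] * P[g | mF.comap Z] := by
        filter_upwards [h2] with ω hω
        rw [Pi.mul_apply, Pi.mul_apply, hω]

/-- Global Markov property of a Gaussian vector: if the precision matrix `L` has no entries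
between `A` and `B`, then `X_A` and `X_B` are conditionally independent given the other entries. -/
theorem condIndepGiven_of_precision {Ω ι : Type*} {mΩ : MeasurableSpace Ω} [Fintype ι]
    [DecidableEq ι] {P : Measure Ω} [IsProbabilityMeasure P] {X : Ω → ι → ℝ} (hX : Measurable X)
    (hG : HasGaussianLaw X P) {L : Matrix ι ι ℝ} (hL : L.PosDef)
    (hcov : L * (Matrix.of fun i j => cov[fun ω => X ω i, fun ω => X ω j; P]) = 1)
    {A B C : Set ι} (hABC : ∀ i, i ∉ A → i ∉ C → i ∈ B) (hAC : Disjoint C A) (hAB : Disjoint B A)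
    (h0 : ∀ a ∈ A, ∀ b ∈ B, L a b = 0) :
    CondIndepGiven (MeasurableSpace.comap (fun ω (c : C) => X ω c) inferInstance)
      (MeasurableSpace.comap (fun ω (a : A) => X ω a) inferInstance)
      (MeasurableSpace.comap (fun ω (b : B) => X ω b) inferInstance) P := by
  classical
  have hXi : ∀ i, Measurable fun ω => X ω i := fun i => (measurable_pi_apply i).comp hX
  have hXL : ∀ i, MemLp (fun ω => X ω i) 2 P := fun i => (hG.eval i).memLp_two
  let U : Ω → A → ℝ := fun ω a => ∑ i, L a i * X ω i
  let W : Ω → {i // i ∉ A} → ℝ := fun ω i => X ω i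
  have hU : Measurable U := measurable_pi_iff.2 fun a =>
    Finset.measurable_fun_sum _ fun i _ => (hXi i).const_mul _
  have hUW : IndepFun U W P := by
    refine HasGaussianLaw.indepFun_of_covariance_eval (X := fun (a : A) ω => ∑ i, L a i * X ω i)
      (Y := fun (i : {i // i ∉ A}) ω => X ω i) ?_ ?_
    · let T : (ι → ℝ) →ₗ[ℝ] (A → ℝ) × ({i // i ∉ A} → ℝ) :=
        (LinearMap.pi fun a : A => ∑ i, L a i • LinearMap.proj i).prod
          (LinearMap.pi fun i : {i // i ∉ A} => LinearMap.proj i.1)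
      refine (hG.map_fun (LinearMap.toContinuousLinearMap T)).congr (.of_forall fun ω => ?_)
      simp only [LinearMap.coe_toContinuousLinearMap']
      ext <;> simp [T]
    · intro a i
      rw [covariance_fun_sum_left (fun j => (hXL j).const_mul _) (hXL i)]
      simp_rw [covariance_const_mul_left]
      have := congrFun (congrFun hcov a) i
      rw [Matrix.mul_apply] at this
      simp only [Matrix.of_apply] at this
      rw [this, Matrix.one_apply_ne]
      rintro h
      exact i.2 (h ▸ a.2)
  have hindep : IndepFun U (fun ω => (fun c : C => X ω c, fun b : B => X ω b)) P := by
    let φ : ({i // i ∉ A} → ℝ) → (C → ℝ) × (B → ℝ) := fun w =>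
      (fun c => w ⟨c, hAC.notMem_of_mem_left c.2⟩, fun b => w ⟨b, hAB.notMem_of_mem_left b.2⟩)
    exact hUW.comp (φ := id) (ψ := φ) measurable_id (by fun_prop)
  refine condIndepGiven_of_indepFun hU (measurable_pi_iff.2 fun c => hXi c)
    (measurable_pi_iff.2 fun b => hXi b) hindep ?_
  rw [← measurable_iff_comap_le]
  let LA : Matrix A A ℝ := L.submatrix Subtype.val Subtype.val
  have hLA : LA.PosDef := hL.submatrix Subtype.val_injective
  have hrep : (fun ω (a : A) => X ω a) = fun ω =>
      LA⁻¹.mulVec fun a => U ω a - ∑ i : {i // i ∉ A}, L a i * X ω i := by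
    ext1 ω
    have : (fun a => U ω a - ∑ i : {i // i ∉ A}, L a i * X ω i) =
        LA.mulVec fun a => X ω a := by
      ext a
      rw [sub_eq_iff_eq_add]
      exact (Fintype.sum_subtype_add_sum_subtype (· ∈ A) fun i => L a i * X ω i).symm
    rw [this, Matrix.mulVec_mulVec, Matrix.nonsing_inv_mul _ ((Matrix.isUnit_iff_isUnit_det _).1
      hLA.isUnit), Matrix.one_mulVec]
  rw [hrep]
  set m := MeasurableSpace.comap (fun ω => (U ω, fun c : C => X ω c)) inferInstance with hm
  have hmU : ∀ a, Measurable[m] fun ω => U ω a := fun a =>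
    (measurable_pi_apply a).comp 
      (measurable_fst.comp (comap_measurable fun ω => (U ω, fun c : C => X ω c)))
  have hmC : ∀ c ∈ C, Measurable[m] fun ω => X ω c := fun c hc =>
    (measurable_pi_apply (⟨c, hc⟩ : C)).comp
      (measurable_snd.comp (comap_measurable fun ω => (U ω, fun c : C => X ω c)))
  refine measurable_pi_iff.2 fun a => ?_
  refine Finset.measurable_fun_sum _ fun a' _ => Measurable.const_mul ?_ _
  refine (hmU a').sub (Finset.measurable_fun_sum _ fun i _ => ?_)
  by_cases hi : i.1 ∈ C
  · exact (hmC i hi).const_mul _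
  · simp [h0 a' a'.2 i (hABC i i.2 hi)]

theorem sigmaOf_eq_comap {Ω : Type*} {d N : ℕ} (x : ℕ → Ω → Fin d → ℝ) {S : Set ℕ}
    (hS : ∀ i ∈ S, i ≤ N) :
    sigmaOf x S = MeasurableSpace.comap
      (fun ω (p : {p : Fin (N + 1) × Fin d | (p.1 : ℕ) ∈ S}) => x p.1.1 ω p.1.2)
      inferInstance := by
  refine le_antisymm (iSup₂_le fun i hi => ?_) ?_
  · rw [← measurable_iff_comap_le]
    refine @measurable_pi_iff _ _ _ (_) _ _ |>.2 fun j => ?_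
    exact (measurable_pi_apply (⟨(⟨i, Nat.lt_succ_of_le (hS i hi)⟩, j), hi⟩ :
      {p : Fin (N + 1) × Fin d | (p.1 : ℕ) ∈ S})).comp
      (comap_measurable fun ω (p : {p : Fin (N + 1) × Fin d | (p.1 : ℕ) ∈ S}) => x p.1.1 ω p.1.2)
  · rw [← measurable_iff_comap_le]
    refine @measurable_pi_iff _ _ _ (_) _ _ |>.2 fun p => ?_
    have h : MeasurableSpace.comap (x p.1.1) inferInstance ≤ sigmaOf x S :=
      le_iSup₂_of_le (f := fun i (_ : i ∈ S) => MeasurableSpace.comap (x i) inferInstance)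
        (p.1.1 : ℕ) p.2 le_rfl
    exact ((measurable_pi_apply p.1.2).comp (comap_measurable _)).mono h le_rfl

/-- Block version of `condIndepGiven_of_precision` for sequences. -/
theorem condIndepGiven_sigmaOf {Ω : Type*} {mΩ : MeasurableSpace Ω} {N d : ℕ} {P : Measure Ω}
    [IsProbabilityMeasure P] {x : ℕ → Ω → Fin d → ℝ} (hx : IsZMNG N x P)
    {L : Matrix (Fin (N + 1) × Fin d) (Fin (N + 1) × Fin d) ℝ} (hL : L.PosDef)
    (hcov : L * fullCov N x P = 1) {A B C : Set ℕ} (hA : ∀ i ∈ A, i ≤ N) (hB : ∀ i ∈ B, i ≤ N)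
    (hC : ∀ i ∈ C, i ≤ N) (hABC : ∀ i ≤ N, i ∉ A → i ∉ C → i ∈ B) (hAC : Disjoint C A)
    (hAB : Disjoint B A)
    (h0 : ∀ p q : Fin (N + 1) × Fin d, (p.1 : ℕ) ∈ A → (q.1 : ℕ) ∈ B → L p q = 0) :
    CondIndepGiven (sigmaOf x C) (sigmaOf x A) (sigmaOf x B) P := by
  rw [sigmaOf_eq_comap x hA, sigmaOf_eq_comap x hB, sigmaOf_eq_comap x hC]
  refine condIndepGiven_of_precision (X := fun ω (p : Fin (N + 1) × Fin d) => x p.1 ω p.2)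
    (measurable_pi_iff.2 fun p => (measurable_pi_apply p.2).comp
      (hx.measurable p.1 (Nat.lt_succ_iff.1 p.1.2)))
    hx.gaussian hL hcov (fun p hpA hpC => hABC p.1 (Nat.lt_succ_iff.1 p.1.2) hpA hpC) ?_ ?_
    fun p hp q hq => h0 p q hp hq
  · exact Set.disjoint_left.2 fun p hp hp' => Set.disjoint_left.1 hAC hp hp'
  · exact Set.disjoint_left.2 fun p hp hp' => Set.disjoint_left.1 hAB hp hp'

/-- The matrix over `[0, N] × [1, d]` with blocks `M a b`. -/
def ofBlocks (N : ℕ) {d : ℕ} (M : ℕ → ℕ → Matrix (Fin d) (Fin d) ℝ) :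
    Matrix (Fin (N + 1) × Fin d) (Fin (N + 1) × Fin d) ℝ :=
  Matrix.of fun p q => M p.1 q.1 p.2 q.2

/-- Blocks of a block diagonal matrix. -/
def diagBlocks {d : ℕ} (M : ℕ → Matrix (Fin d) (Fin d) ℝ) (a b : ℕ) : Matrix (Fin d) (Fin d) ℝ :=
  if a = b then M a else 0

theorem ofBlocks_apply {N d : ℕ} (M : ℕ → ℕ → Matrix (Fin d) (Fin d) ℝ)
    (p q : Fin (N + 1) × Fin d) : ofBlocks N M p q = M p.1 q.1 p.2 q.2 := rfl

theorem ofBlocks_mul {N d : ℕ} (A B : ℕ → ℕ → Matrix (Fin d) (Fin d) ℝ) :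
    ofBlocks N A * ofBlocks N B =
      ofBlocks N fun a b => ∑ k ∈ Finset.range (N + 1), A a k * B k b := by
  ext ⟨a, i⟩ ⟨b, j⟩
  simp only [Matrix.mul_apply, Fintype.sum_prod_type, ofBlocks_apply, Matrix.sum_apply]
  exact Fin.sum_univ_eq_sum_range (fun k => ∑ l, A a k i l * B k b l j) (N + 1)

theorem ofBlocks_transpose {N d : ℕ} (A : ℕ → ℕ → Matrix (Fin d) (Fin d) ℝ) :
    (ofBlocks N A).transpose = ofBlocks N fun a b => (A b a).transpose := rfl

theorem ofBlocks_mul_diag {N d : ℕ} (A : ℕ → ℕ → Matrix (Fin d) (Fin d) ℝ)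
    (M : ℕ → Matrix (Fin d) (Fin d) ℝ) :
    ofBlocks N A * ofBlocks N (diagBlocks M) = ofBlocks N fun a b => A a b * M b := by
  rw [ofBlocks_mul]
  ext ⟨a, i⟩ ⟨b, j⟩
  have : (b : ℕ) ∈ Finset.range (N + 1) := Finset.mem_range.2 b.2
  simp only [ofBlocks_apply, diagBlocks, mul_ite, mul_zero, Finset.sum_ite_eq', this, if_true]

theorem ofBlocks_diag_one (N d : ℕ) :
    ofBlocks N (diagBlocks fun _ => (1 : Matrix (Fin d) (Fin d) ℝ)) = 1 := by
  ext ⟨a, i⟩ ⟨b, j⟩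
  by_cases h : a = b <;>
    simp [ofBlocks_apply, diagBlocks, Matrix.one_apply, h, Fin.val_inj]

theorem ofBlocks_diag_inv {N d : ℕ} {M : ℕ → Matrix (Fin d) (Fin d) ℝ}
    (hM : ∀ k ≤ N, (M k).PosDef) :
    (ofBlocks N (diagBlocks M))⁻¹ = ofBlocks N (diagBlocks fun k => (M k)⁻¹) := by
  refine Matrix.inv_eq_right_inv ?_
  rw [ofBlocks_mul_diag, ← ofBlocks_diag_one]
  ext ⟨a, i⟩ ⟨b, j⟩
  by_cases h : a = b
  · subst h
    simp [ofBlocks_apply, diagBlocks, Matrix.mul_nonsing_inv _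
      ((Matrix.isUnit_iff_isUnit_det _).1 (hM a (Nat.lt_succ_iff.1 a.2)).isUnit)]
  · simp [ofBlocks_apply, diagBlocks, h, Fin.val_inj]

theorem ofBlocks_diag_posDef {N d : ℕ} {M : ℕ → Matrix (Fin d) (Fin d) ℝ}
    (hM : ∀ k ≤ N, (M k).PosDef) : (ofBlocks N (diagBlocks M)).PosDef := by
  refine .of_dotProduct_mulVec_pos ?_ fun v hv => ?_
  · ext ⟨a, i⟩ ⟨b, j⟩
    by_cases h : a = b
    · subst h
      have := congrFun (congrFun (hM a (Nat.lt_succ_iff.1 a.2)).isHermitian i) j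
      simpa [ofBlocks_apply, diagBlocks, Matrix.conjTranspose_apply] using this
    · simp [ofBlocks_apply, diagBlocks, h, Ne.symm h, Fin.val_inj, Matrix.conjTranspose_apply]
  · have hsum : star v ⬝ᵥ (ofBlocks N (diagBlocks M)).mulVec v =
        ∑ a : Fin (N + 1), star (fun i => v (a, i)) ⬝ᵥ (M a).mulVec fun i => v (a, i) := by
      simp only [dotProduct, Matrix.mulVec, Fintype.sum_prod_type, ofBlocks_apply, diagBlocks]
      refine Finset.sum_congr rfl fun a _ => Finset.sum_congr rfl fun i _ => ?_
      congr 1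
      rw [Finset.sum_eq_single a]
      · simp
      · intro b _ hb
        simp [Fin.val_inj, hb.symm]
      · simp
    rw [hsum]
    obtain ⟨⟨a, i⟩, hai⟩ := Function.ne_iff.1 hv
    refine Finset.sum_pos' (fun b _ =>
      (hM b (Nat.lt_succ_iff.1 b.2)).posSemidef.dotProduct_mulVec_nonneg _) ⟨a, Finset.mem_univ _, ?_⟩
    exact (hM a (Nat.lt_succ_iff.1 a.2)).dotProduct_mulVec_pos fun h => hai (congrFun h i)

/-- The vector `(x_0', …, x_N')'`. -/
def stack (N : ℕ) {d : ℕ} (x : ℕ → Fin d → ℝ) (p : Fin (N + 1) × Fin d) : ℝ := x p.1 p.2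

theorem exists_stack_eq {N d : ℕ} (v : Fin (N + 1) × Fin d → ℝ) :
    ∃ x : ℕ → Fin d → ℝ, stack N x = v :=
  ⟨fun k i => if h : k < N + 1 then v (⟨k, h⟩, i) else 0, by ext ⟨a, i⟩; exact dif_pos a.2⟩

theorem ofBlocks_mulVec_stack {N d : ℕ} (M : ℕ → ℕ → Matrix (Fin d) (Fin d) ℝ)
    (x : ℕ → Fin d → ℝ) :
    (ofBlocks N M).mulVec (stack N x) =
      stack N fun a => ∑ k ∈ Finset.range (N + 1), (M a k).mulVec (x k) := by
  ext ⟨a, i⟩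
  simp only [Matrix.mulVec, dotProduct, Fintype.sum_prod_type, ofBlocks_apply, stack,
    Finset.sum_apply]
  exact Fin.sum_univ_eq_sum_range (fun k => ∑ l, M a k i l * x k l) (N + 1)

theorem covariance_congr_ae {Ω : Type*} {mΩ : MeasurableSpace Ω} {P : Measure Ω}
    {X X' Y Y' : Ω → ℝ} (hX : X =ᵐ[P] X') (hY : Y =ᵐ[P] Y') : cov[X, Y; P] = cov[X', Y'; P] := by
  unfold covariance
  rw [integral_congr_ae hX, integral_congr_ae hY]
  refine integral_congr_ae ?_
  filter_upwards [hX, hY] with ω h1 h2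
  rw [h1, h2]

/-- A sequence that is transformed into a ZMNG sequence by an invertible matrix is ZMNG; its
precision matrix is the transformed precision matrix. -/
theorem isZMNG_of_mulVec_eq {Ω : Type*} {mΩ : MeasurableSpace Ω} {N d : ℕ} {P : Measure Ω}
    {x e : ℕ → Ω → Fin d → ℝ} (hx : ∀ k ≤ N, Measurable (x k)) (he : IsZMNG N e P)
    {T : Matrix (Fin (N + 1) × Fin d) (Fin (N + 1) × Fin d) ℝ} (hT : IsUnit T.det)
    (hTx : ∀ᵐ ω ∂P, T.mulVec (stack N fun k => x k ω) = stack N fun k => e k ω) :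
    IsZMNG N x P ∧ (T.transpose * (fullCov N e P)⁻¹ * T) * fullCov N x P = 1 := by
  have hxe : ∀ᵐ ω ∂P, T⁻¹.mulVec (stack N fun k => e k ω) = stack N fun k => x k ω := by
    filter_upwards [hTx] with ω hω
    rw [← hω, Matrix.mulVec_mulVec, Matrix.nonsing_inv_mul _ hT, Matrix.one_mulVec]
  have hG : HasGaussianLaw (fun ω => stack N fun k => x k ω) P :=
    (he.gaussian.map_fun (LinearMap.toContinuousLinearMap (Matrix.toLin' T⁻¹))).congr <| by
      filter_upwards [hxe] with ω hω
      rw [← hω]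
      rfl
  have hx2 : ∀ p : Fin (N + 1) × Fin d, MemLp (fun ω => x p.1 ω p.2) 2 P := fun p =>
    (hG.eval p).memLp_two
  have hQ : T * fullCov N x P * T.transpose = fullCov N e P := by
    have := hG.isProbabilityMeasure
    ext p q
    have hp : ∀ p : Fin (N + 1) × Fin d,
        (fun ω => e p.1 ω p.2) =ᵐ[P] fun ω => ∑ r, T p r * x r.1 ω r.2 := fun p => by
      filter_upwards [hTx] with ω hω
      exact (congrFun hω p).symm
    have h1 : fullCov N e P p q =
        cov[fun ω => ∑ r, T p r * x r.1 ω r.2, fun ω => ∑ r, T q r * x r.1 ω r.2; P] :=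
      covariance_congr_ae (hp p) (hp q)
    rw [h1, covariance_fun_sum_fun_sum (fun r => (hx2 r).const_mul _)
      (fun r => (hx2 r).const_mul _)]
    simp_rw [covariance_const_mul_left, covariance_const_mul_right]
    rw [Matrix.mul_apply, Finset.sum_comm]
    refine Finset.sum_congr rfl fun s _ => ?_
    rw [Matrix.mul_apply, Finset.sum_mul]
    refine Finset.sum_congr rfl fun r _ => ?_
    rw [Matrix.transpose_apply, mul_assoc, mul_comm (T q s)]
    rfl
  have hinv : (T.transpose * (fullCov N e P)⁻¹ * T) * fullCov N x P = 1 := by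
    have h1 : T * (fullCov N x P * (T.transpose * (fullCov N e P)⁻¹)) = 1 := by
      rw [← mul_assoc, ← mul_assoc, hQ, Matrix.mul_nonsing_inv _ he.nonsingular.isUnit]
    rw [mul_eq_one_comm, mul_assoc, mul_assoc] at h1
    rw [mul_eq_one_comm, ← h1]
    simp only [mul_assoc]
  refine ⟨⟨hx, hG, fun k hk i => ?_, fun h => ?_⟩, hinv⟩
  · have hk' : (fun ω => x k ω i) =ᵐ[P] fun ω =>
        ∑ r : Fin (N + 1) × Fin d, T⁻¹ (⟨k, Nat.lt_succ_of_le hk⟩, i) r * e r.1 ω r.2 := by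
      filter_upwards [hxe] with ω hω
      exact (congrFun hω (⟨k, Nat.lt_succ_of_le hk⟩, i)).symm
    rw [integral_congr_ae hk', integral_finsetSum _ fun r _ =>
      ((he.gaussian.eval r).integrable).const_mul _]
    refine Finset.sum_eq_zero fun r _ => ?_
    rw [integral_const_mul, he.zeroMean r.1 (Nat.lt_succ_iff.1 r.1.2), mul_zero]
  · have := congrArg Matrix.det hinv
    rw [Matrix.det_mul, h, mul_zero, Matrix.det_one] at this
    exact zero_ne_one this

variable {N d : ℕ} (G : CMLModel N d) (b : Boundary d)

/-- The coefficient of `x N` in the equation for `x k`, `k < N`. -/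
def lastCoeff (k : ℕ) : Matrix (Fin d) (Fin d) ℝ := if k = 0 then b.G0N else G.last k

/-- Blocks of the matrix that maps a sequence to its driving noise. -/
def evolBlocks (a c : ℕ) : Matrix (Fin d) (Fin d) ℝ :=
  (if a = c then 1 else 0) - (if c = N ∧ a < N then lastCoeff G b a else 0) -
    (if a = c + 1 ∧ a < N then G.prev a else 0)

theorem noiseCov_posDef (k : ℕ) (hk : k ≤ N) : (noiseCov G b k).PosDef := by
  unfold noiseCov
  split_ifs with h0 hN
  · exact b.G0_posDef
  · exact b.GN_posDef
  · exact G.cov_posDef k (by omega) (by omega)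

theorem sum_evolBlocks_mulVec (x : ℕ → Fin d → ℝ) {a : ℕ} (ha : a ≤ N) :
    ∑ k ∈ Finset.range (N + 1), (evolBlocks G b a k).mulVec (x k) =
      x a - (if a < N then (lastCoeff G b a).mulVec (x N) else 0) -
        (if 1 ≤ a ∧ a < N then (G.prev a).mulVec (x (a - 1)) else 0) := by
  simp only [evolBlocks, Matrix.sub_mulVec, Finset.sum_sub_distrib]
  congr 1
  · congr 1
    · rw [Finset.sum_eq_single a]
      · simp
      · intro k _ hk
        simp [hk.symm]
      · intro h
        exact absurd (Finset.mem_range.2 (Nat.lt_succ_of_le ha)) h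
    · rw [Finset.sum_eq_single N]
      · by_cases h : a < N <;> simp [h]
      · intro k _ hk
        simp [hk]
      · simp
  · by_cases h : 1 ≤ a ∧ a < N
    · rw [Finset.sum_eq_single (a - 1)]
      · have h1 : a = a - 1 + 1 ∧ a < N := by omega
        rw [if_pos h1, if_pos h]
      · intro k _ hk
        have h1 : ¬ (a = k + 1 ∧ a < N) := by omega
        rw [if_neg h1, Matrix.zero_mulVec]
      · intro h1
        exact absurd (Finset.mem_range.2 (by omega)) h1
    · rw [if_neg h]
      refine Finset.sum_eq_zero fun k _ => ?_
      have h1 : ¬ (a = k + 1 ∧ a < N) := by omega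
      rw [if_neg h1, Matrix.zero_mulVec]

theorem mulVec_stack_eq_iff (hN : 2 ≤ N) (x e : ℕ → Fin d → ℝ) :
    (ofBlocks N (evolBlocks G b)).mulVec (stack N x) = stack N e ↔
      (∀ k, 1 ≤ k → k < N →
        x k = (G.prev k).mulVec (x (k - 1)) + (G.last k).mulVec (x N) + e k) ∧
      x N = e N ∧ x 0 = b.G0N.mulVec (x N) + e 0 := by
  rw [ofBlocks_mulVec_stack]
  have hstack : (stack N (fun a => ∑ k ∈ Finset.range (N + 1), (evolBlocks G b a k).mulVec (x k)) =
      stack N e) ↔ ∀ a ≤ N, x a - (if a < N then (lastCoeff G b a).mulVec (x N) else 0) -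
        (if 1 ≤ a ∧ a < N then (G.prev a).mulVec (x (a - 1)) else 0) = e a := by
    constructor
    · intro h a ha
      rw [← sum_evolBlocks_mulVec G b x ha]
      ext i
      exact congrFun h (⟨a, Nat.lt_succ_of_le ha⟩, i)
    · intro h
      ext ⟨a, i⟩
      have ha : (a : ℕ) ≤ N := Nat.lt_succ_iff.1 a.2
      have := congrFun ((sum_evolBlocks_mulVec G b x ha).trans (h a ha)) i
      exact this
  rw [hstack]
  constructor
  · intro h
    refine ⟨fun k h1 h2 => ?_, ?_, ?_⟩
    · rw [← h k h2.le]
      simp only [h1, h2, lastCoeff, Nat.one_le_iff_ne_zero.1 h1, if_true, if_false, and_self]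
      abel
    · simpa using h N le_rfl
    · rw [← h 0 (Nat.zero_le _)]
      simp [lastCoeff, show 0 < N by omega]
  · rintro ⟨h1, h2, h3⟩ a ha
    rcases Nat.eq_zero_or_pos a with rfl | h0
    · have : 0 < N := by omega
      simp only [this, if_true, lastCoeff, h3]
      simp
    · rcases ha.lt_or_eq with h | rfl
      · rw [h1 a h0 h]
        simp only [h, if_true, lastCoeff, h0.ne', if_false, and_true, Nat.one_le_iff_ne_zero,
          ne_eq, not_false_eq_true]
        abel
      · simpa using h2

theorem isUnit_det_evolBlocks (hN : 2 ≤ N) : IsUnit (ofBlocks N (evolBlocks G b)).det := by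
  rw [isUnit_iff_ne_zero]
  intro hdet
  obtain ⟨v, hv, hv0⟩ := Matrix.exists_mulVec_eq_zero_iff.2 hdet
  obtain ⟨x, rfl⟩ := exists_stack_eq v
  obtain ⟨h1, h2, h3⟩ := (mulVec_stack_eq_iff G b hN x 0).1 hv0
  have hN0 : x N = 0 := h2
  have hlt : ∀ k < N, x k = 0 := by
    intro k
    induction k with
    | zero => intro _; simp [h3, hN0]
    | succ k ih =>
      intro hk
      rw [h1 (k + 1) (by omega) hk, hN0, Nat.add_sub_cancel, ih (by omega)]
      simp
  refine hv ?_
  ext ⟨a, i⟩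
  rcases (Nat.lt_succ_iff.1 a.2).lt_or_eq with h | h
  · exact congrFun (hlt a h) i
  · simp [stack, h, hN0]

/-- The precision matrix of a sequence obeying the model. -/
noncomputable def precision : Matrix (Fin (N + 1) × Fin d) (Fin (N + 1) × Fin d) ℝ :=
  (ofBlocks N (evolBlocks G b)).transpose * (ofBlocks N (diagBlocks (noiseCov G b)))⁻¹ *
    ofBlocks N (evolBlocks G b)

theorem precision_posDef (hN : 2 ≤ N) : (precision G b).PosDef :=
  (ofBlocks_diag_posDef (noiseCov_posDef G b)).inv.conjTranspose_mul_mul_same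
    (Matrix.mulVec_injective_iff_isUnit.2
      ((Matrix.isUnit_iff_isUnit_det _).2 (isUnit_det_evolBlocks G b hN)))

theorem evolBlocks_transpose {a : ℕ} (ha : a < N) (k : ℕ) :
    (evolBlocks G b k a).transpose = (if k = a then 1 else 0) -
      (if k = a + 1 then if a + 1 < N then (G.prev (a + 1)).transpose else 0 else 0) := by
  have h1 : ¬ (a = N ∧ k < N) := by omega
  rw [evolBlocks, if_neg h1, sub_zero, Matrix.transpose_sub]
  congr 1
  · split_ifs <;> simp
  · by_cases h : k = a + 1
    · subst h
      by_cases h2 : a + 1 < N <;> simp [h2]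
    · simp [h]

theorem precision_apply (p q : Fin (N + 1) × Fin d) (hp : (p.1 : ℕ) < N) :
    precision G b p q = ((noiseCov G b p.1)⁻¹ * evolBlocks G b p.1 q.1 -
      (if (p.1 : ℕ) + 1 < N then (G.prev (p.1 + 1)).transpose else 0) *
        (noiseCov G b (p.1 + 1))⁻¹ * evolBlocks G b (p.1 + 1) q.1) p.2 q.2 := by
  rw [precision, ofBlocks_diag_inv (noiseCov_posDef G b), ofBlocks_transpose, ofBlocks_mul_diag,
    ofBlocks_mul, ofBlocks_apply]
  have h1 : (p.1 : ℕ) ∈ Finset.range (N + 1) := Finset.mem_range.2 (by omega)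
  have h2 : (p.1 : ℕ) + 1 ∈ Finset.range (N + 1) := Finset.mem_range.2 (by omega)
  simp only [evolBlocks_transpose G b hp, sub_mul, Finset.sum_sub_distrib, ite_mul, one_mul,
    zero_mul, Finset.sum_ite_eq', h1, h2, if_true]

theorem evolBlocks_eq_zero {a c : ℕ} (h1 : a ≠ c) (h2 : c ≠ N) (h3 : a ≠ c + 1) :
    evolBlocks G b a c = 0 := by
  simp [evolBlocks, h1, h2, h3]

theorem evolBlocks_last {a : ℕ} (h : a < N) : evolBlocks G b a N = -lastCoeff G b a := by
  have h1 : a ≠ N := by omega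
  have h2 : a ≠ N + 1 := by omega
  simp [evolBlocks, h, h1, h2]

/-- The precision matrix vanishes between non-neighbouring states, if the first of them satisfies
the reciprocity condition. -/
theorem precision_eq_zero (p q : Fin (N + 1) × Fin d)
    (hr : ((p.1 : ℕ) + 1 < N → (noiseCov G b p.1)⁻¹ * lastCoeff G b p.1 =
      (G.prev (p.1 + 1)).transpose * (noiseCov G b (p.1 + 1))⁻¹ * lastCoeff G b (p.1 + 1)))
    (hp : (p.1 : ℕ) < N) (h : (p.1 : ℕ) ≠ q.1) (h1 : (p.1 : ℕ) ≠ q.1 + 1)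
    (h2 : (p.1 : ℕ) + 1 ≠ q.1) : precision G b p q = 0 := by
  rw [precision_apply G b p q hp]
  by_cases hq : (q.1 : ℕ) = N
  · have hlt : (p.1 : ℕ) + 1 < N := by omega
    rw [hq, evolBlocks_last G b hp, evolBlocks_last G b hlt, if_pos hlt, mul_neg, mul_neg, hr hlt,
      sub_self, Matrix.zero_apply]
  · rw [evolBlocks_eq_zero G b h hq h1, evolBlocks_eq_zero G b h2 hq (by omega), mul_zero, mul_zero,
      sub_zero, Matrix.zero_apply]

theorem CMLModel.IsReciprocalModel.noiseCov_inv_mul {G : CMLModel N d} (hG : G.IsReciprocalModel)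
    {k : ℕ} (hk : 1 ≤ k) (hkN : k + 1 < N) : (noiseCov G b k)⁻¹ * lastCoeff G b k =
      (G.prev (k + 1)).transpose * (noiseCov G b (k + 1))⁻¹ * lastCoeff G b (k + 1) := by
  have h1 : k ≠ N := by omega
  have h2 : k + 1 ≠ N := by omega
  simpa [noiseCov, lastCoeff, Nat.one_le_iff_ne_zero.1 hk, h1, h2] using hG k hk (by omega)

theorem noiseCov_zero_inv_mul (hN : 2 ≤ N)
    (hb : b.G0N = b.G0 * (G.prev 1).transpose * (G.cov 1)⁻¹ * G.last 1) :
    (noiseCov G b 0)⁻¹ * lastCoeff G b 0 =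
      (G.prev 1).transpose * (noiseCov G b 1)⁻¹ * lastCoeff G b 1 := by
  have h1 : 1 ≠ N := by omega
  simp only [noiseCov, lastCoeff, if_true, h1, one_ne_zero, if_false]
  rw [hb, mul_assoc, mul_assoc, ← mul_assoc, Matrix.nonsing_inv_mul _
    ((Matrix.isUnit_iff_isUnit_det _).1 b.G0_posDef.isUnit), one_mul, mul_assoc]

section Obeys

variable {G b} {Ω : Type*} {mΩ : MeasurableSpace Ω} {P : Measure Ω} {x : ℕ → Ω → Fin d → ℝ}

theorem fullCov_eq_of_isWhiteNG {e : ℕ → Ω → Fin d → ℝ} {Q : ℕ → Matrix (Fin d) (Fin d) ℝ}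
    (he : IsWhiteNG N e Q P) : fullCov N e P = ofBlocks N (diagBlocks Q) := by
  ext ⟨k, i⟩ ⟨l, j⟩
  have hk := Nat.lt_succ_iff.1 k.2
  have hl := Nat.lt_succ_iff.1 l.2
  change crossCov e P k l i j = diagBlocks Q k l i j
  unfold diagBlocks
  split_ifs with h
  · rw [← h, he.cov_self k hk]
  · rw [he.cov_ne k hk l hl h]

theorem Obeys.isZMNG_and_precision (hN : 2 ≤ N) (h : Obeys G b x P) :
    IsZMNG N x P ∧ precision G b * fullCov N x P = 1 := by
  obtain ⟨hx, e, he, h1, h2, h3⟩ := h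
  have := isZMNG_of_mulVec_eq hx he.zmng (isUnit_det_evolBlocks G b hN) (by
    have h1' : ∀ᵐ ω ∂P, ∀ k, 1 ≤ k → k < N →
        x k ω = (G.prev k).mulVec (x (k - 1) ω) + (G.last k).mulVec (x N ω) + e k ω := by
      simpa only [ae_all_iff] using h1
    filter_upwards [h1', h2, h3] with ω g1 g2 g3
    exact (mulVec_stack_eq_iff G b hN (fun k => x k ω) fun k => e k ω).2 ⟨g1, g2, g3⟩)
  rwa [fullCov_eq_of_isWhiteNG he] at this

theorem Obeys.isReciprocal [IsProbabilityMeasure P] (hN : 2 ≤ N) (hG : G.IsReciprocalModel)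
    (h : Obeys G b x P) : IsReciprocal N x P := by
  obtain ⟨hz, hprec⟩ := h.isZMNG_and_precision hN
  intro j l hjl hl
  refine condIndepGiven_sigmaOf hz (precision_posDef G b hN) hprec ?_ ?_ ?_ ?_ ?_ ?_ ?_
  · rintro i ⟨_, hi⟩; omega
  · rintro i (hi | ⟨_, hi⟩) <;> omega
  · rintro i (rfl | rfl) <;> omega
  · intro i hi h1 h2
    simp only [Set.mem_ofPred_eq, Set.mem_insert_iff, Set.mem_singleton_iff] at h1 h2 ⊢
    omega
  · refine Set.disjoint_left.2 ?_
    rintro i (rfl | rfl) ⟨h1, h2⟩ <;> omega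
  · refine Set.disjoint_left.2 ?_
    rintro i (h1 | h1) ⟨h2, h3⟩ <;> omega
  · rintro p q ⟨hp1, hp2⟩ hq
    simp only [Set.mem_ofPred_eq] at hq
    exact precision_eq_zero G b p q (hG.noiseCov_inv_mul b (by omega)) (by omega) (by omega)
      (by omega) (by omega)

theorem Obeys.isMarkov [IsProbabilityMeasure P] (hN : 2 ≤ N) (hG : G.IsReciprocalModel)
    (hb : b.G0N = b.G0 * (G.prev 1).transpose * (G.cov 1)⁻¹ * G.last 1)
    (h : Obeys G b x P) : IsMarkov N x P := by
  obtain ⟨hz, hprec⟩ := h.isZMNG_and_precision hN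
  intro k hk
  refine condIndepGiven_sigmaOf hz (precision_posDef G b hN) hprec ?_ ?_ ?_ ?_ ?_ ?_ ?_
  · intro i (hi : i < k); omega
  · rintro i ⟨_, hi⟩; exact hi
  · rintro i rfl; exact hk
  · intro i hi h1 h2
    simp only [Set.mem_ofPred_eq, Set.mem_singleton_iff] at h1 h2 ⊢
    omega
  · refine Set.disjoint_left.2 ?_
    rintro i rfl (h1 : i < i); omega
  · refine Set.disjoint_left.2 ?_
    rintro i ⟨h1, _⟩ (h2 : i < k); omega
  · rintro p q (hp : (p.1 : ℕ) < k) ⟨hq, hq'⟩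
    refine precision_eq_zero G b p q (fun hlt => ?_) (by omega) (by omega) (by omega) (by omega)
    rcases Nat.eq_zero_or_pos (p.1 : ℕ) with h0 | h0
    · rw [h0]
      exact noiseCov_zero_inv_mul G b hN hb
    · exact hG.noiseCov_inv_mul b h0 hlt

end Obeys

theorem exists_isWhiteNG {Q : ℕ → Matrix (Fin d) (Fin d) ℝ} (hQ : ∀ k ≤ N, (Q k).PosDef) :
    ∃ (Ω : Type) (_ : MeasurableSpace Ω) (P : Measure Ω) (e : ℕ → Ω → Fin d → ℝ),
      IsProbabilityMeasure P ∧ IsWhiteNG N e Q P := by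
  have hpos := ofBlocks_diag_posDef hQ
  set S := ofBlocks N (diagBlocks Q) with hS
  let P : Measure (EuclideanSpace ℝ (Fin (N + 1) × Fin d)) := multivariateGaussian 0 S
  let e : ℕ → EuclideanSpace ℝ (Fin (N + 1) × Fin d) → Fin d → ℝ := fun k ω i =>
    if h : k < N + 1 then ω (⟨k, h⟩, i) else 0
  have hek : ∀ k (hk : k ≤ N) i, (fun ω => e k ω i) = fun ω => ω (⟨k, Nat.lt_succ_of_le hk⟩, i) :=
    fun k hk i => funext fun ω => dif_pos (Nat.lt_succ_of_le hk)
  have hcov : ∀ k ≤ N, ∀ l ≤ N, crossCov e P k l = diagBlocks Q k l := by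
    intro k hk l hl
    ext i j
    rw [crossCov, Matrix.of_apply, hek k hk i, hek l hl j]
    exact covariance_eval_multivariateGaussian hpos.posSemidef _ _
  have hfull : fullCov N e P = S := by
    ext p q
    rw [fullCov, Matrix.of_apply, hcov _ (Nat.lt_succ_iff.1 p.1.2) _ (Nat.lt_succ_iff.1 q.1.2)]
    rfl
  refine ⟨EuclideanSpace ℝ (Fin (N + 1) × Fin d), inferInstance, P, e,
    inferInstanceAs (IsProbabilityMeasure (multivariateGaussian 0 S)),
    ⟨fun k hk => measurable_pi_iff.2 fun i => ?_, ?_, fun k hk i => ?_, ?_⟩, fun k hk => ?_,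
    fun k hk l hl hkl => ?_⟩
  · rw [hek k hk i]
    fun_prop
  · have hid : HasGaussianLaw (id : EuclideanSpace ℝ (Fin (N + 1) × Fin d) → _) P :=
      IsGaussian.hasGaussianLaw_id
    refine (hid.map_fun (PiLp.continuousLinearEquiv 2 ℝ
      fun _ : Fin (N + 1) × Fin d => ℝ).toContinuousLinearMap).congr (.of_forall fun ω => ?_)
    ext ⟨k, i⟩
    exact (congrFun (hek k (Nat.lt_succ_iff.1 k.2) i) ω).symm
  · rw [hek k hk i]
    have := ContinuousLinearMap.integral_comp_comm (μ := P)
      (EuclideanSpace.proj (𝕜 := ℝ) (⟨k, Nat.lt_succ_of_le hk⟩, i) :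
        EuclideanSpace ℝ (Fin (N + 1) × Fin d) →L[ℝ] ℝ) (φ := id) IsGaussian.integrable_id
    simp only [id] at this
    rw [integral_id_multivariateGaussian] at this
    simpa using this
  · rw [hfull]
    exact hpos.det_pos.ne'
  · rw [hcov k hk k hk, diagBlocks, if_pos rfl]
  · rw [hcov k hk l hl, diagBlocks, if_neg hkl]

theorem exists_obeys (hN : 2 ≤ N) :
    ∃ (Ω : Type) (_ : MeasurableSpace Ω) (P : Measure Ω) (x : ℕ → Ω → Fin d → ℝ),
      IsProbabilityMeasure P ∧ Obeys G b x P := by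
  obtain ⟨Ω, mΩ, P, e, hP, he⟩ := exists_isWhiteNG (noiseCov_posDef G b)
  set T := ofBlocks N (evolBlocks G b) with hT
  let x : ℕ → Ω → Fin d → ℝ := fun k ω i =>
    if h : k < N + 1 then T⁻¹.mulVec (stack N fun k => e k ω) (⟨k, h⟩, i) else 0
  have hx : ∀ ω, stack N (fun k => x k ω) = T⁻¹.mulVec (stack N fun k => e k ω) := fun ω => by
    ext ⟨a, i⟩
    exact dif_pos a.2
  have hobey := fun ω => (mulVec_stack_eq_iff G b hN (fun k => x k ω) fun k => e k ω).1 (by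
    rw [hx, Matrix.mulVec_mulVec, Matrix.mul_nonsing_inv _ (isUnit_det_evolBlocks G b hN),
      Matrix.one_mulVec])
  refine ⟨Ω, mΩ, P, x, hP, fun k hk => measurable_pi_iff.2 fun i => ?_, e, he,
    fun k h1 h2 => .of_forall fun ω => (hobey ω).1 k h1 h2,
    .of_forall fun ω => (hobey ω).2.1, .of_forall fun ω => (hobey ω).2.2⟩
  simp only [x, dif_pos (Nat.lt_succ_of_le hk)]
  exact Finset.measurable_fun_sum _ fun r _ => ((measurable_pi_apply r.2).comp
    (he.zmng.measurable r.1 (Nat.lt_succ_iff.1 r.1.2))).const_mul _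

end CMSeq

theorem mainTheorem12 (N d : ℕ) (hN : 2 ≤ N) (G : CMSeq.CMLModel N d)
    (hG : G.IsReciprocalModel) :
    -- every boundary condition is realised, and always by ZMNG reciprocal sequences
    (∀ b : CMSeq.Boundary d,
      (∃ (Ω : Type) (_ : MeasurableSpace Ω) (P : Measure Ω) (x : ℕ → Ω → Fin d → ℝ),
        IsProbabilityMeasure P ∧ CMSeq.Obeys G b x P) ∧
      (∀ (Ω : Type*) (_ : MeasurableSpace Ω) (P : Measure Ω) (_ : IsProbabilityMeasure P)
        (x : ℕ → Ω → Fin d → ℝ), CMSeq.Obeys G b x P →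
          CMSeq.IsZMNG N x P ∧ CMSeq.IsReciprocal N x P)) ∧
    -- some of the modeled reciprocal sequences are Markov
    (∃ (b : CMSeq.Boundary d) (Ω : Type) (_ : MeasurableSpace Ω) (P : Measure Ω)
      (x : ℕ → Ω → Fin d → ℝ), IsProbabilityMeasure P ∧ CMSeq.Obeys G b x P ∧
        CMSeq.IsZMNG N x P ∧ CMSeq.IsReciprocal N x P ∧ CMSeq.IsMarkov N x P) ∧
    -- the displayed choice of the boundary condition gives Markov sequences
    (∀ b : CMSeq.Boundary d,
      b.G0N = b.G0 * (G.prev 1).transpose * (G.cov 1)⁻¹ * G.last 1 →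
      ∀ (Ω : Type*) (_ : MeasurableSpace Ω) (P : Measure Ω) (_ : IsProbabilityMeasure P)
        (x : ℕ → Ω → Fin d → ℝ), CMSeq.Obeys G b x P → CMSeq.IsMarkov N x P) := by
  refine ⟨fun b => ⟨CMSeq.exists_obeys G b hN, fun Ω _ P _ x h =>
    ⟨(h.isZMNG_and_precision hN).1, h.isReciprocal hN hG⟩⟩, ?_,
    fun b hb Ω _ P _ x h => h.isMarkov hN hG hb⟩
  let b : CMSeq.Boundary d :=
    ⟨1 * (G.prev 1).transpose * (G.cov 1)⁻¹ * G.last 1, 1, 1, .one, .one⟩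
  obtain ⟨Ω, mΩ, P, x, hP, h⟩ := CMSeq.exists_obeys G b hN
  exact ⟨b, Ω, mΩ, P, x, hP, h, (h.isZMNG_and_precision hN).1, h.isReciprocal hN hG,
    h.isMarkov hN hG rfl⟩
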